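/- Let $n\ge 1$, $\alpha>0$, $T>0$, $L\in(0,1)$ and $\Omega=(0,\pi)^n$. For a multi-index $j=(j_1,\dots,j_n)$ of positive integers put $$\phi_j(x)=\Big(\frac2\pi\Big)^{n/2}\prod_{k=1}^n\sin(j_kx_k),\qquad \lambda_j=\Big(\sum_{k=1}^n j_k^2\Big)^{\alpha},\qquad \gamma_j(T)=\frac{e^{2\lambda_jT}-1}{2\lambda_j},$$ so that $(\phi_j)$ is the usual Hilbert basis of $L^2(\Omega)$ of eigenfunctions of $A_0=(-\Delta)^\alpha$ ($\Delta$ the Dirichlet-Laplacian, the power being defined spectrally) and $(\lambda_j)$ are the eigenvalues. Write $\mathbf 1=(1,\dots,1)$. Let $\mathcal U_L$ be the set of measurable $\omega\subset\Omega$ with $|\omega|=L|\Omega|$, and let $$J(\omega)=\inf_{j}\gamma_j(T)\int_\omega\phi_j(x)^2\,dx .$$ Let $F(s)=\frac1\pi(s-\sin s)$ on $[0,\pi]$, let $f(u)=F(\pi u)=u-\frac1\pi\sin(\pi u)$ on $[0,1]$, and let $f^{[n]}$ be the $n$-fold composition of $f$ with itself (for $n=1$, $f^{[1]}(s/\pi)=F(s)$).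 1. (Uniform lower bound.) For every measurable $\rho:\Omega\to[0,1]$ and every multi-index $j$, $$\int_\Omega\rho\,\phi_j^2\,dx\ \ge\ f^{[n]}\Big(\pi^{-n}\int_\Omega\rho\,dx\Big),$$ and the right-hand side is positive if $\int_\Omega\rho>0$. 2. (Assumption $(H_2)$.) For every $a\in L^\infty(\Omega;[0,1])$ with $\int_\Omega a\,dx=L|\Omega|$, $$\liminf_{|j|\to\infty}\gamma_j(T)\int_\Omega a\,\phi_j^2\,dx>\gamma_{\mathbf 1}(T).$$ 3. (Optimal set.) There is an open semi-analytic set $\omega^*\in\mathcal U_L$ that maximizes $J$ over $\mathcal U_L$, and every maximizer of $J$ over $\mathcal U_L$ equals $\omega^*$ up to a set of measure zero. 4. (Explicit number of modes.) The multi-indices can be listed as a sequence $\sigma(1),\sigma(2),\dots$ (each exactly once) with $\lambda_{\sigma(1)}\le\lambda_{\sigma(2)}\le\cdots$. For any such enumeration there is a least integer $N_0\ge1$ with $$\gamma_{\sigma(N_0)}(T)\ \ge\ \frac{\gamma_{\mathbf 1}(T)}{f^{[n]}(L)},$$ and for every $N\ge N_0$ the set $\omega^*$ is also the unique (up to null sets)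 maximizer over $\mathcal U_L$ of the truncated functional $J_N(\omega)=\min_{1\le i\le N}\gamma_{\sigma(i)}(T)\int_\omega\phi_{\sigma(i)}^2\,dx$, and $J_N(\omega^*)=J(\omega^*)$. -/

import Mathlib

open MeasureTheory Filter Topology

noncomputable section

/-- The open orthotope `(0, π)^n`. -/
def orthotope (n : ℕ) : Set (Fin n → ℝ) :=
  Set.univ.pi fun _ => Set.Ioo 0 Real.pi

/-- The eigenfunction `(2/π)^{n/2} ∏ₖ sin (jₖ xₖ)` of the Dirichlet-Laplacian on `(0, π)^n`,
for a multi-index `j` of positive integers. -/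
def sineMode {n : ℕ} (j : Fin n → ℕ+) (x : Fin n → ℝ) : ℝ :=
  (2 / Real.pi) ^ ((n : ℝ) / 2) * ∏ k, Real.sin ((j k : ℝ) * x k)

/-- The eigenvalue of `(-Δ)^α` (spectral fractional power of the Dirichlet-Laplacian) on
`sineMode j`: the `α`-th power of the Laplace eigenvalue `∑ₖ jₖ²`. -/
def modeEigenvalue {n : ℕ} (α : ℝ) (j : Fin n → ℕ+) : ℝ :=
  (∑ k, (j k : ℝ) ^ 2) ^ α

/-- The weight attached to a real eigenvalue `lam` and an observation time `T`,
that is, `∫₀ᵀ exp (2 lam t) dt`. -/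
def timeWeight (lam T : ℝ) : ℝ :=
  if lam = 0 then T else (Real.exp (2 * lam * T) - 1) / (2 * lam)

/-- The weight `γ_j(T)` of the mode `j`. -/
def modeWeight {n : ℕ} (α T : ℝ) (j : Fin n → ℕ+) : ℝ :=
  timeWeight (modeEigenvalue α j) T

/-- Lebesgue measurable subsets `ω` of the orthotope with `|ω| = L |Ω|`. -/
def admissibleSets (n : ℕ) (L : ℝ) : Set (Set (Fin n → ℝ)) :=
  {ω | ω ⊆ orthotope n ∧ NullMeasurableSet ω volume ∧
    volume ω = ENNReal.ofReal L * volume (orthotope n)}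

/-- `ρ` represents an element of `L^∞(Ω; [0,1])`. -/
def IsDensity (n : ℕ) (ρ : (Fin n → ℝ) → ℝ) : Prop :=
  AEStronglyMeasurable ρ (volume.restrict (orthotope n)) ∧
    ∀ᵐ x ∂volume.restrict (orthotope n), ρ x ∈ Set.Icc (0 : ℝ) 1

/-- The functional `J(χ_ω) = inf_j γ_j(T) ∫_ω φ_j²`. -/
def obsFunctional {n : ℕ} (α T : ℝ) (ω : Set (Fin n → ℝ)) : ℝ :=
  ⨅ j : Fin n → ℕ+, modeWeight α T j * ∫ x in ω, sineMode j x ^ 2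

/-- `σ` lists all modes, by nondecreasing eigenvalue. -/
def IsOrderedEnumeration {n : ℕ} (α : ℝ) (σ : ℕ+ ≃ (Fin n → ℕ+)) : Prop :=
  Monotone fun i => modeEigenvalue α (σ i)

/-- The truncated functional `J_N(χ_ω)`: the infimum runs over the first `N` modes only. -/
def truncFunctional {n : ℕ} (α T : ℝ) (σ : ℕ+ ≃ (Fin n → ℕ+)) (N : ℕ+)
    (ω : Set (Fin n → ℝ)) : ℝ :=
  ⨅ i : Set.Iic N, modeWeight α T (σ i) * ∫ x in ω, sineMode (σ i) x ^ 2

/-- The spectral assumption `(H₂)`. The inferior limit is taken in the extended reals, and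
along the cofinite filter of the modes, which is the limit `i → ∞` for any enumeration. -/
def SpectralH2 (n : ℕ) (α T L : ℝ) : Prop :=
  ∀ a : (Fin n → ℝ) → ℝ, IsDensity n a →
    ∫ x in orthotope n, a x = L * volume.real (orthotope n) →
    ((modeWeight α T (fun _ : Fin n => (1 : ℕ+)) : ℝ) : EReal) <
      liminf (fun j : Fin n → ℕ+ =>
        ((modeWeight α T j * ∫ x in orthotope n, a x * sineMode j x ^ 2 : ℝ) : EReal)) cofinite

/-- The function `F(s) = (s - sin s)/π`. -/
def sineGap (s : ℝ) : ℝ := (s - Real.sin s) / Real.pi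

/-- The lower bound `f^{[n]}(s / π^n)`, the `n`-fold composition of
`f(u) = F(π u) = u - sin(π u)/π`. For `n = 1` this is `F(s)`. -/
def sineLowerBound (n : ℕ) (s : ℝ) : ℝ :=
  (fun u => sineGap (Real.pi * u))^[n] (s / Real.pi ^ n)

/-- Semi-analytic subsets of a real normed space: near every point of the space the set is a
finite union of sets given by finitely many equations and strict inequalities between real
analytic functions. -/
def IsSemiAnalytic {E : Type*} [NormedAddCommGroup E] [NormedSpace ℝ E] (S : Set E) : Prop :=
  ∀ x : E, ∃ U : Set E, IsOpen U ∧ x ∈ U ∧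
    ∃ (p q r : ℕ) (f : Fin p → Fin q → E → ℝ) (g : Fin p → Fin r → E → ℝ),
      (∀ i k, AnalyticOnNhd ℝ (f i k) U) ∧ (∀ i k, AnalyticOnNhd ℝ (g i k) U) ∧
      S ∩ U = {y | y ∈ U ∧ ∃ i, (∀ k, f i k y = 0) ∧ ∀ k, 0 < g i k y}

/-- `ω` maximizes `Φ` over the admissible sets, and every other maximizer differs from `ω` by
a null set only. -/
def IsUniqueOptimalSet (n : ℕ) (L : ℝ) (Φ : Set (Fin n → ℝ) → ℝ) (ω : Set (Fin n → ℝ)) : Prop :=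
  ω ∈ admissibleSets n L ∧ (∀ ω' ∈ admissibleSets n L, Φ ω' ≤ Φ ω) ∧
    ∀ ω' ∈ admissibleSets n L, Φ ω' = Φ ω → ω' =ᵐ[volume] ω

end

/-!
Since `(2/π) sin² (j s) = (1 - cos (2 j s))/π`, the bathtub principle bounds the mass of a density
`ρ` on `(0, π)` weighted by a squared mode from below by `f` of the average of `ρ`. As `f` is convex
and monotone, applying this on slices and using Jensen's inequality adds one composition with `f`
per dimension, whence the bound `f^{[n]}`. Because the weights `γ_j` tend to infinity while the
masses stay above `f^{[n]}(L) > 0`, every mode past `N₀` contributes at least `γ_𝟏` to the infimum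
`J`, and the first mode contributes at most that: `J` is a minimum over finitely many modes.

A minimum of finitely many linear functionals `ω ↦ ∫_ω g_i` is maximized by duality. For `b` in the
simplex, the superlevel set of `∑ b_i g_i` with the prescribed volume is the unique maximizer of
`ω ↦ ∫_ω ∑ b_i g_i`, because the level sets of a nonconstant analytic function are null. It depends
continuously on `b`, so some `b` minimizes the maximal value. The first-order condition at this `b`
says that it charges only those `i` for which `∫_ω g_i` is minimal, `ω` being its superlevel set,
and `ω` is then the unique maximizer of the minimum. It is open and semi-analytic since `∑ b_i g_i`
is analytic.
-/

theorem ae_ne_zero_of_analyticOnNhd_real {F : Type*} [NormedAddCommGroup F] [NormedSpace ℝ F]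
    {f : ℝ → F} (hf : AnalyticOnNhd ℝ f Set.univ) {t : ℝ} (ht : f t ≠ 0) :
    ∀ᵐ s, f s ≠ 0 := by
  have hae : f ⁻¹' {0}ᶜ ∈ ae (volume.restrict Set.univ) :=
    ae_restrict_le_codiscreteWithin MeasurableSet.univ (hf.preimage_zero_mem_codiscrete ht)
  rwa [Measure.restrict_univ] at hae

-- Restrict to the lines through a point where `f` does not vanish, and exchange the quantifiers:
-- for almost every scale `t`, the function `y ↦ f (x + t • y)` is almost everywhere nonzero.
theorem ae_ne_zero_of_analyticOnNhd {E F : Type*} [NormedAddCommGroup E] [NormedSpace ℝ E]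
    [FiniteDimensional ℝ E] [MeasurableSpace E] [BorelSpace E] [NormedAddCommGroup F]
    [NormedSpace ℝ F] (μ : Measure E) [μ.IsAddHaarMeasure] {f : E → F}
    (hf : AnalyticOnNhd ℝ f Set.univ) {x : E} (hx : f x ≠ 0) : ∀ᵐ y ∂μ, f y ≠ 0 := by
  have hcont : Continuous f := by simpa only [continuousOn_univ] using hf.continuousOn
  have hmeas : MeasurableSet {p : ℝ × E | f (x + p.1 • p.2) ≠ 0} :=
    (isOpen_ne_fun (hcont.comp (by fun_prop)) continuous_const).measurableSet
  have hlines : ∀ᵐ y ∂μ, ∀ᵐ t : ℝ, f (x + t • y) ≠ 0 := ae_of_all _ fun y =>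
    ae_ne_zero_of_analyticOnNhd_real (t := 0)
      (fun t _ => (hf _ trivial).comp (f := fun t : ℝ => x + t • y) (by fun_prop))
      (by simpa only [zero_smul, add_zero] using hx)
  have hscales : ∀ᵐ t : ℝ, ∀ᵐ y ∂μ, f (x + t • y) ≠ 0 :=
    (Measure.ae_ae_comm hmeas).2 hlines
  obtain ⟨t, ht, ht0⟩ := (hscales.and (Measure.ae_ne volume 0)).exists
  have hpre : μ ((t • ·) ⁻¹' ((x + ·) ⁻¹' {y | f y = 0})) = 0 := by
    simpa only [ne_eq, not_not, ae_iff] using! ht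
  rw [Measure.addHaar_preimage_smul μ ht0, mul_eq_zero, measure_preimage_add] at hpre
  simpa only [ae_iff, ne_eq, not_not] using hpre.resolve_left (by positivity)

section Bathtub

variable {X ι : Type*} [MeasurableSpace X] {μ : Measure X} {l : Filter ι}

theorem tendsto_measure_zero_of_absolutelyContinuous {ν : Measure X} [IsFiniteMeasure μ]
    [SigmaFinite ν] (hμν : μ ≪ ν) {s : ι → Set X} (hs : Tendsto (fun i => ν (s i)) l (𝓝 0)) :
    Tendsto (fun i => μ (s i)) l (𝓝 0) := by
  simpa only [Measure.setLIntegral_rnDeriv hμν] using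
    tendsto_setLIntegral_zero (Measure.lintegral_rnDeriv_lt_top μ ν).ne hs

theorem tendsto_measure_zero_of_tendsto_setIntegral_zero [IsFiniteMeasure μ] {f : X → ℝ}
    (hf : Integrable f μ) (hpos : ∀ᵐ x ∂μ, 0 < f x) {s : ι → Set X}
    (hs : Tendsto (fun i => ∫ x in s i, f x ∂μ) l (𝓝 0)) :
    Tendsto (fun i => μ (s i)) l (𝓝 0) := by
  have hac : μ ≪ μ.withDensity fun x => ENNReal.ofReal (f x) :=
    withDensity_absolutelyContinuous' hf.aemeasurable.ennreal_ofReal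
      (hpos.mono fun x hx => (ENNReal.ofReal_pos.2 hx).ne')
  refine tendsto_measure_zero_of_absolutelyContinuous hac ?_
  simp_rw [withDensity_apply', fun i => (ofReal_integral_eq_lintegral_ofReal
    hf.integrableOn (ae_restrict_of_ae (hpos.mono fun _ hx => hx.le)) :
      ENNReal.ofReal (∫ x in s i, f x ∂μ) = _).symm]
  simpa only [ENNReal.ofReal_zero] using ENNReal.tendsto_ofReal hs

theorem tendsto_setIntegral_of_tendsto_measure_symmDiff {g : X → ℝ} (hg : Integrable g μ)
    {s : ι → Set X} {t : Set X} (hs : ∀ i, NullMeasurableSet (s i) μ)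
    (ht : NullMeasurableSet t μ) (h : Tendsto (fun i => μ (symmDiff (s i) t)) l (𝓝 0)) :
    Tendsto (fun i => ∫ x in s i, g x ∂μ) l (𝓝 (∫ x in t, g x ∂μ)) := by
  have hdiff : ∀ i, ∫ x in s i, g x ∂μ =
      ∫ x in s i \ t, g x ∂μ - ∫ x in t \ s i, g x ∂μ + ∫ x in t, g x ∂μ := fun i => by
    have h1 := integral_inter_add_sdiff₀ (f := g) (s := s i) ht hg.integrableOn
    have h2 := integral_inter_add_sdiff₀ (f := g) (s := t) (hs i) hg.integrableOn
    rw [Set.inter_comm] at h2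
    linarith
  have hzero : ∀ u : ι → Set X, (∀ i, u i ⊆ symmDiff (s i) t) →
      Tendsto (fun i => ∫ x in u i, g x ∂μ) l (𝓝 0) := fun u hu =>
    hg.tendsto_setIntegral_nhds_zero (tendsto_of_tendsto_of_tendsto_of_le_of_le
      tendsto_const_nhds h (fun _ => zero_le) fun i => measure_mono (hu i))
  simp_rw [hdiff]
  simpa only [sub_zero, zero_add] using
    ((hzero _ fun i => le_sup_left).sub (hzero _ fun i => le_sup_right)).add_const
      (∫ x in t, g x ∂μ)

theorem continuous_measureReal_Ioi (ν : Measure ℝ) [IsFiniteMeasure ν]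
    [NullSingletonClass ν] : Continuous fun ξ => ν.real (Set.Ioi ξ) := by
  refine continuous_iff_continuousAt.2 fun ξ => ?_
  refine (ENNReal.tendsto_toReal (measure_ne_top _ _)).comp
    (tendsto_measure_of_ae_tendsto_indicator_of_isFiniteMeasure _ measurableSet_Ioi
      (fun _ => measurableSet_Ioi) ?_)
  filter_upwards [Measure.ae_ne ν ξ] with y hy
  rcases lt_or_gt_of_ne hy with h | h
  · filter_upwards [lt_mem_nhds h] with η hη
    simp only [Set.mem_Ioi, hη.not_gt, h.not_gt]
  · filter_upwards [gt_mem_nhds h] with η hη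
    simp only [Set.mem_Ioi, hη, h]

theorem exists_measureReal_Ioi_eq (ν : Measure ℝ) [IsFiniteMeasure ν] [NullSingletonClass ν]
    {m : ℝ} (hm : m ∈ Set.Ioo 0 (ν.real Set.univ)) : ∃ ξ, ν.real (Set.Ioi ξ) = m := by
  have hsmall : ∃ ξ, ν.real (Set.Ioi ξ) ≤ m := by
    have hlim := (ENNReal.tendsto_toReal (measure_ne_top ν _)).comp (tendsto_measure_Iic_atTop ν)
    obtain ⟨ξ, hξ⟩ := (hlim.eventually_const_lt (sub_lt_self _ hm.1)).exists
    refine ⟨ξ, ?_⟩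
    rw [← Set.compl_Iic, measureReal_compl measurableSet_Iic]
    exact (sub_lt_comm.1 hξ).le
  have hlarge : ∃ ξ, m ≤ ν.real (Set.Ioi ξ) := by
    have hlim := (ENNReal.tendsto_toReal (measure_ne_top ν _)).comp (tendsto_measure_Ici_atBot ν)
    obtain ⟨ξ, hξ⟩ := (hlim.eventually_const_lt hm.2).exists
    exact ⟨ξ, hξ.le.trans_eq (measureReal_congr Ioi_ae_eq_Ici.symm)⟩
  exact mem_range_of_exists_le_of_exists_ge (continuous_measureReal_Ioi ν) hsmall hlarge

section FiniteMeasure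

variable [IsFiniteMeasure μ] {ψ : X → ℝ} {ξ : ℝ} {ω : Set X}

theorem exists_measureReal_superlevel_eq (hψ : AEMeasurable ψ μ)
    (hlev : ∀ ξ, μ {x | ψ x = ξ} = 0) {m : ℝ} (hm : m ∈ Set.Ioo 0 (μ.real Set.univ)) :
    ∃ ξ, μ.real {x | ξ < ψ x} = m := by
  have hnull : NullSingletonClass (μ.map ψ) := ⟨fun ξ =>
    (Measure.map_apply_of_aemeasurable hψ (measurableSet_singleton ξ)).trans (hlev ξ)⟩
  have hmap : ∀ s, MeasurableSet s → (μ.map ψ).real s = μ.real (ψ ⁻¹' s) := fun s hs =>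
    map_measureReal_apply_of_aemeasurable hψ hs
  obtain ⟨ξ, hξ⟩ := exists_measureReal_Ioi_eq (μ.map ψ) (by rwa [hmap _ MeasurableSet.univ])
  exact ⟨ξ, (hmap _ measurableSet_Ioi).symm.trans hξ⟩

theorem setIntegral_superlevel_sub_setIntegral (hψ : Integrable ψ μ)
    (hω : NullMeasurableSet ω μ) (hm : μ.real ω = μ.real {x | ξ < ψ x}) :
    ∫ x in {x | ξ < ψ x}, ψ x ∂μ - ∫ x in ω, ψ x ∂μ =
      ∫ x in symmDiff {x | ξ < ψ x} ω, |ψ x - ξ| ∂μ := by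
  have hs : NullMeasurableSet {x | ξ < ψ x} μ := nullMeasurableSet_lt aemeasurable_const
    hψ.aemeasurable
  have hint : Integrable (fun x => ψ x - ξ) μ := hψ.sub (integrable_const _)
  have hshift : ∀ s : Set X, ∫ x in s, (ψ x - ξ) ∂μ = ∫ x in s, ψ x ∂μ - μ.real s * ξ := by
    intro s
    rw [integral_sub hψ.integrableOn (integrable_const _).integrableOn, setIntegral_const,
      smul_eq_mul]
  calc ∫ x in {x | ξ < ψ x}, ψ x ∂μ - ∫ x in ω, ψ x ∂μ
      = ∫ x in {x | ξ < ψ x}, (ψ x - ξ) ∂μ - ∫ x in ω, (ψ x - ξ) ∂μ := by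
        rw [hshift, hshift, hm, sub_sub_sub_cancel_right]
    _ = ∫ x, ({x | ξ < ψ x}.indicator (fun x => ψ x - ξ) x -
          ω.indicator (fun x => ψ x - ξ) x) ∂μ := by
        rw [integral_sub (hint.indicator₀ hs) (hint.indicator₀ hω), integral_indicator₀ hs,
          integral_indicator₀ hω]
    _ = ∫ x, (symmDiff {x | ξ < ψ x} ω).indicator (fun x => |ψ x - ξ|) x ∂μ := by
        refine integral_congr_ae (ae_of_all _ fun x => ?_)
        by_cases hx : ξ < ψ x <;> by_cases hxω : x ∈ ω <;>
          simp [Set.indicator, Set.mem_symmDiff, hx, hxω, abs_of_pos, abs_of_nonpos, not_lt.1]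
    _ = ∫ x in symmDiff {x | ξ < ψ x} ω, |ψ x - ξ| ∂μ := integral_indicator₀ (hs.symmDiff hω)

theorem setIntegral_le_setIntegral_superlevel (hψ : Integrable ψ μ)
    (hω : NullMeasurableSet ω μ) (hm : μ.real ω = μ.real {x | ξ < ψ x}) :
    ∫ x in ω, ψ x ∂μ ≤ ∫ x in {x | ξ < ψ x}, ψ x ∂μ := by
  rw [← sub_nonneg, setIntegral_superlevel_sub_setIntegral hψ hω hm]
  exact integral_nonneg fun x => abs_nonneg _

theorem tendsto_measure_symmDiff_superlevel (hψ : Integrable ψ μ) (hlev : μ {x | ψ x = ξ} = 0)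
    {ω : ι → Set X} (hω : ∀ i, NullMeasurableSet (ω i) μ)
    (hm : ∀ i, μ.real (ω i) = μ.real {x | ξ < ψ x})
    (h : Tendsto (fun i => ∫ x in ω i, ψ x ∂μ) l (𝓝 (∫ x in {x | ξ < ψ x}, ψ x ∂μ))) :
    Tendsto (fun i => μ (symmDiff (ω i) {x | ξ < ψ x})) l (𝓝 0) := by
  simp_rw [symmDiff_comm _ {x | ξ < ψ x}]
  refine tendsto_measure_zero_of_tendsto_setIntegral_zero
    (hψ.sub (integrable_const ξ)).abs ?_ ?_
  · filter_upwards [show ∀ᵐ x ∂μ, ψ x ≠ ξ by simpa only [ae_iff, ne_eq, not_not]] with x hx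
    exact abs_pos.2 (sub_ne_zero.2 hx)
  · simp_rw [Pi.sub_apply, ← fun i => setIntegral_superlevel_sub_setIntegral hψ (hω i) (hm i)]
    simpa only [sub_self] using h.const_sub (∫ x in {x | ξ < ψ x}, ψ x ∂μ)

theorem ae_eq_superlevel_of_setIntegral_eq (hψ : Integrable ψ μ) (hlev : μ {x | ψ x = ξ} = 0)
    (hω : NullMeasurableSet ω μ) (hm : μ.real ω = μ.real {x | ξ < ψ x})
    (h : ∫ x in ω, ψ x ∂μ = ∫ x in {x | ξ < ψ x}, ψ x ∂μ) : ω =ᵐ[μ] {x | ξ < ψ x} := by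
  have hlim := tendsto_measure_symmDiff_superlevel (l := (atTop : Filter ℕ)) hψ hlev
    (fun _ => hω) (fun _ => hm) (h ▸ tendsto_const_nhds)
  exact measure_symmDiff_eq_zero_iff.1 (tendsto_nhds_unique tendsto_const_nhds hlim)

theorem tendsto_measure_symmDiff_superlevel_of_tendsto_L1 (hψ : Integrable ψ μ)
    (hlev : μ {x | ψ x = ξ} = 0) {φ : ι → X → ℝ} {η : ι → ℝ} (hφ : ∀ i, Integrable (φ i) μ)
    (hm : ∀ i, μ.real {x | η i < φ i x} = μ.real {x | ξ < ψ x})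
    (h : Tendsto (fun i => ∫ x, |φ i x - ψ x| ∂μ) l (𝓝 0)) :
    Tendsto (fun i => μ (symmDiff {x | η i < φ i x} {x | ξ < ψ x})) l (𝓝 0) := by
  have hnull : ∀ i, NullMeasurableSet {x | η i < φ i x} μ := fun i =>
    nullMeasurableSet_lt aemeasurable_const (hφ i).aemeasurable
  have hclose : ∀ i (s : Set X),
      |∫ x in s, φ i x ∂μ - ∫ x in s, ψ x ∂μ| ≤ ∫ x, |φ i x - ψ x| ∂μ := fun i s => by
    rw [← integral_sub (hφ i).integrableOn hψ.integrableOn]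
    exact abs_integral_le_integral_abs.trans (setIntegral_le_integral ((hφ i).sub hψ).abs
      (ae_of_all _ fun x => abs_nonneg _))
  refine tendsto_measure_symmDiff_superlevel hψ hlev hnull hm ?_
  have hlower : Tendsto (fun i => ∫ x in {x | ξ < ψ x}, ψ x ∂μ - 2 * ∫ x, |φ i x - ψ x| ∂μ) l
      (𝓝 (∫ x in {x | ξ < ψ x}, ψ x ∂μ)) := by
    simpa only [mul_zero, sub_zero] using (h.const_mul 2).const_sub _
  refine tendsto_of_tendsto_of_tendsto_of_le_of_le hlower tendsto_const_nhds (fun i => ?_)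
    fun i => setIntegral_le_setIntegral_superlevel hψ (hnull i) (hm i)
  have hopt := setIntegral_le_setIntegral_superlevel (ω := {x | ξ < ψ x}) (hφ i)
    (nullMeasurableSet_lt aemeasurable_const hψ.aemeasurable) (hm i).symm
  have h1 := abs_le.1 (hclose i {x | ξ < ψ x})
  have h2 := abs_le.1 (hclose i {x | η i < φ i x})
  change _ - 2 * _ ≤ _
  linarith [h1.1, h2.2]

end FiniteMeasure

theorem exists_forall_dotProduct_le [Fintype ι] [Nonempty ι] {v : stdSimplex ℝ ι → ι → ℝ}
    (hv : Continuous v) (hopt : ∀ b c : stdSimplex ℝ ι, b ⬝ᵥ v c ≤ b ⬝ᵥ v b) :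
    ∃ b : stdSimplex ℝ ι, ∀ i, b ⬝ᵥ v b ≤ v b i := by
  classical
  have hcont : Continuous fun b : stdSimplex ℝ ι => b ⬝ᵥ v b :=
    continuous_subtype_val.dotProduct hv
  obtain ⟨b, -, hb⟩ := isCompact_univ.exists_isMinOn Set.univ_nonempty hcont.continuousOn
  refine ⟨b, fun i => ?_⟩
  set t : ℕ → ℝ := fun k => 1 / ((k : ℝ) + 1)
  have ht0 : ∀ k, 0 < t k := fun k => Nat.one_div_pos_of_nat
  have ht1 : ∀ k, t k ≤ 1 := fun k => div_le_one_of_le₀ (by simp) (by positivity)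
  let c : ℕ → stdSimplex ℝ ι := fun k => ⟨(1 - t k) • b.1 + t k • Pi.single i 1,
    convex_stdSimplex ℝ ι b.2 (single_mem_stdSimplex ℝ i) (sub_nonneg.2 (ht1 k)) (ht0 k).le
      (sub_add_cancel 1 (t k))⟩
  have hcoe : ∀ k, ⇑(c k) = (1 - t k) • ⇑b + t k • Pi.single i 1 := fun _ => rfl
  have hc : Tendsto c atTop (𝓝 b) := by
    have ht : Tendsto t atTop (𝓝 0) := tendsto_one_div_add_atTop_nhds_zero_nat
    rw [tendsto_subtype_rng]
    simpa only [sub_zero, one_smul, zero_smul, add_zero] using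
      ((ht.const_sub 1).smul_const b.1).add (ht.smul_const (Pi.single i (1 : ℝ)))
  refine ge_of_tendsto' (tendsto_pi_nhds.1 ((hv.tendsto b).comp hc) i) fun k => ?_
  have hmin : b ⬝ᵥ v b ≤ (1 - t k) * (b ⬝ᵥ v b) + t k * v (c k) i := calc
    b ⬝ᵥ v b ≤ c k ⬝ᵥ v (c k) := hb (Set.mem_univ (c k))
    _ = (1 - t k) * (b ⬝ᵥ v (c k)) + t k * v (c k) i := by
      rw [hcoe, add_dotProduct, smul_dotProduct, smul_dotProduct, single_dotProduct, one_mul,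
        smul_eq_mul, smul_eq_mul]
    _ ≤ (1 - t k) * (b ⬝ᵥ v b) + t k * v (c k) i := by
      gcongr
      · exact sub_nonneg.2 (ht1 k)
      · exact hopt b (c k)
  refine le_of_mul_le_mul_left ?_ (ht0 k)
  change t k * _ ≤ t k * v (c k) i
  linarith

theorem iInf_le_dotProduct [Fintype ι] {b : ι → ℝ} (hb : b ∈ stdSimplex ℝ ι) (v : ι → ℝ) :
    ⨅ i, v i ≤ b ⬝ᵥ v := calc
  ⨅ i, v i = ∑ j, b j * ⨅ i, v i := by rw [← Finset.sum_mul, hb.2, one_mul]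
  _ ≤ b ⬝ᵥ v := Finset.sum_le_sum fun j _ =>
    mul_le_mul_of_nonneg_left (ciInf_le (Set.finite_range v).bddBelow j) (hb.1 j)

variable [Fintype ι] {g : ι → X → ℝ}

theorem integrable_sum_mul (hg : ∀ i, Integrable (g i) μ) (b : ι → ℝ) :
    Integrable (fun x => ∑ i, b i * g i x) μ :=
  integrable_finsetSum _ fun i _ => (hg i).const_mul (b i)

theorem setIntegral_sum_mul (hg : ∀ i, Integrable (g i) μ) (b : ι → ℝ) (ω : Set X) :
    ∫ x in ω, ∑ i, b i * g i x ∂μ = b ⬝ᵥ fun i => ∫ x in ω, g i x ∂μ := by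
  rw [integral_finsetSum _ fun i _ => ((hg i).const_mul (b i)).integrableOn]
  simp only [integral_const_mul, dotProduct]

theorem tendsto_integral_abs_sum_mul_sub (hg : ∀ i, Integrable (g i) μ) (b : ι → ℝ) :
    Tendsto (fun c : ι → ℝ => ∫ x, |∑ i, c i * g i x - ∑ i, b i * g i x| ∂μ) (𝓝 b) (𝓝 0) := by
  have hle : ∀ c : ι → ℝ, ∫ x, |∑ i, c i * g i x - ∑ i, b i * g i x| ∂μ ≤
      ∑ i, |c i - b i| * ∫ x, |g i x| ∂μ := fun c => by
    simp_rw [← integral_const_mul, ← Finset.sum_sub_distrib, ← sub_mul]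
    rw [← integral_finsetSum _ fun i _ => (hg i).abs.const_mul _]
    refine integral_mono (integrable_sum_mul hg (c - b)).abs
      (integrable_finsetSum _ fun i _ => (hg i).abs.const_mul _) fun x => ?_
    simpa only [abs_mul] using Finset.abs_sum_le_sum_abs (fun i => (c i - b i) * g i x) Finset.univ
  have hlim : Continuous fun c : ι → ℝ => ∑ i, |c i - b i| * ∫ x, |g i x| ∂μ := by fun_prop
  exact squeeze_zero (fun c => integral_nonneg fun x => abs_nonneg _) hle
    (by simpa using hlim.tendsto b)

theorem iInf_setIntegral_le_setIntegral_sum_mul (hg : ∀ i, Integrable (g i) μ)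
    {b : ι → ℝ} (hb : b ∈ stdSimplex ℝ ι) (ω : Set X) :
    ⨅ j, ∫ x in ω, g j x ∂μ ≤ ∫ x in ω, ∑ i, b i * g i x ∂μ := by
  rw [setIntegral_sum_mul hg]
  exact iInf_le_dotProduct hb _

variable [IsFiniteMeasure μ] {b : ι → ℝ} {ξ : ℝ} {ω : Set X}

theorem exists_superlevel_forall_setIntegral_le [Nonempty ι] (hg : ∀ i, Integrable (g i) μ)
    (hlev : ∀ b ∈ stdSimplex ℝ ι, ∀ ξ, μ {x | ∑ i, b i * g i x = ξ} = 0) {m : ℝ}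
    (hm : m ∈ Set.Ioo 0 (μ.real Set.univ)) :
    ∃ b ∈ stdSimplex ℝ ι, ∃ ξ, μ.real {x | ξ < ∑ i, b i * g i x} = m ∧
      ∀ j, ∫ x in {x | ξ < ∑ i, b i * g i x}, ∑ i, b i * g i x ∂μ ≤
        ∫ x in {x | ξ < ∑ i, b i * g i x}, g j x ∂μ := by
  choose ξ hξ using fun b : stdSimplex ℝ ι => exists_measureReal_superlevel_eq
    (integrable_sum_mul hg b).aemeasurable (hlev b b.2) hm
  have hnull : ∀ b : stdSimplex ℝ ι, NullMeasurableSet {x | ξ b < ∑ i, b i * g i x} μ := fun b =>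
    nullMeasurableSet_lt aemeasurable_const (integrable_sum_mul hg b).aemeasurable
  have hcont : Continuous fun (b : stdSimplex ℝ ι) j =>
      ∫ x in {x | ξ b < ∑ i, b i * g i x}, g j x ∂μ := by
    refine continuous_iff_continuousAt.2 fun b => tendsto_pi_nhds.2 fun j =>
      tendsto_setIntegral_of_tendsto_measure_symmDiff (hg j) hnull (hnull b) ?_
    exact tendsto_measure_symmDiff_superlevel_of_tendsto_L1 (integrable_sum_mul hg b)
      (hlev b b.2 _) (fun c => integrable_sum_mul hg c) (fun c => (hξ c).trans (hξ b).symm)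
      ((tendsto_integral_abs_sum_mul_sub hg b).comp continuousAt_subtype_val)
  obtain ⟨b, hb⟩ := exists_forall_dotProduct_le hcont fun b c : stdSimplex ℝ ι => by
    rw [← setIntegral_sum_mul hg, ← setIntegral_sum_mul hg]
    exact setIntegral_le_setIntegral_superlevel (integrable_sum_mul hg b) (hnull c)
      ((hξ c).trans (hξ b).symm)
  refine ⟨b, b.2, ξ b, hξ b, fun j => ?_⟩
  rw [setIntegral_sum_mul hg]
  exact hb j

theorem iInf_setIntegral_le_iInf_setIntegral_superlevel [Nonempty ι]
    (hg : ∀ i, Integrable (g i) μ) (hb : b ∈ stdSimplex ℝ ι)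
    (hbal : ∀ j, ∫ x in {x | ξ < ∑ i, b i * g i x}, ∑ i, b i * g i x ∂μ ≤
      ∫ x in {x | ξ < ∑ i, b i * g i x}, g j x ∂μ)
    (hω : NullMeasurableSet ω μ) (hm : μ.real ω = μ.real {x | ξ < ∑ i, b i * g i x}) :
    ⨅ j, ∫ x in ω, g j x ∂μ ≤ ⨅ j, ∫ x in {x | ξ < ∑ i, b i * g i x}, g j x ∂μ := calc
  ⨅ j, ∫ x in ω, g j x ∂μ ≤ ∫ x in ω, ∑ i, b i * g i x ∂μ :=
    iInf_setIntegral_le_setIntegral_sum_mul hg hb ω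
  _ ≤ ∫ x in {x | ξ < ∑ i, b i * g i x}, ∑ i, b i * g i x ∂μ :=
    setIntegral_le_setIntegral_superlevel (integrable_sum_mul hg b) hω hm
  _ ≤ _ := le_ciInf hbal

theorem ae_eq_superlevel_of_iInf_setIntegral_eq [Nonempty ι] (hg : ∀ i, Integrable (g i) μ)
    (hb : b ∈ stdSimplex ℝ ι) (hlev : μ {x | ∑ i, b i * g i x = ξ} = 0)
    (hbal : ∀ j, ∫ x in {x | ξ < ∑ i, b i * g i x}, ∑ i, b i * g i x ∂μ ≤
      ∫ x in {x | ξ < ∑ i, b i * g i x}, g j x ∂μ)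
    (hω : NullMeasurableSet ω μ) (hm : μ.real ω = μ.real {x | ξ < ∑ i, b i * g i x})
    (h : ⨅ j, ∫ x in ω, g j x ∂μ = ⨅ j, ∫ x in {x | ξ < ∑ i, b i * g i x}, g j x ∂μ) :
    ω =ᵐ[μ] {x | ξ < ∑ i, b i * g i x} := by
  have hψ := integrable_sum_mul hg b
  refine ae_eq_superlevel_of_setIntegral_eq hψ hlev hω hm
    (le_antisymm (setIntegral_le_setIntegral_superlevel hψ hω hm) ?_)
  calc ∫ x in {x | ξ < ∑ i, b i * g i x}, ∑ i, b i * g i x ∂μ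
      ≤ ⨅ j, ∫ x in {x | ξ < ∑ i, b i * g i x}, g j x ∂μ := le_ciInf hbal
    _ = ⨅ j, ∫ x in ω, g j x ∂μ := h.symm
    _ ≤ ∫ x in ω, ∑ i, b i * g i x ∂μ := iInf_setIntegral_le_setIntegral_sum_mul hg hb ω

end Bathtub

section AverageLowerBound

variable {X Y : Type*} [MeasurableSpace X] [MeasurableSpace Y] {μ : Measure X} {ν : Measure Y}

/-- `φ` bounds the mass `∫ ρ w` of every density `ρ : X → [0,1]` from below in terms of the
average of `ρ`. The average rather than the mass is used, so that bounds compose on products. -/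
def AverageLowerBound (μ : Measure X) (w : X → ℝ) (φ : ℝ → ℝ) : Prop :=
  ∀ ρ : X → ℝ, AEStronglyMeasurable ρ μ → (∀ᵐ x ∂μ, ρ x ∈ Set.Icc (0 : ℝ) 1) →
    φ (⨍ x, ρ x ∂μ) ≤ ∫ x, ρ x * w x ∂μ

theorem averageLowerBound_one_id [IsProbabilityMeasure μ] :
    AverageLowerBound μ (fun _ => 1) id := fun ρ _ _ => by
  simp only [id, average_eq_integral, mul_one, le_refl]

theorem AverageLowerBound.comp_measurePreserving {w : Y → ℝ} {φ : ℝ → ℝ}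
    (h : AverageLowerBound ν w φ) {e : X ≃ᵐ Y} (he : MeasurePreserving e μ ν) :
    AverageLowerBound μ (w ∘ e) φ := fun ρ hρ hρ01 => by
  have huniv : μ.real Set.univ = ν.real Set.univ := by
    simpa only [measureReal_def, Set.preimage_univ] using
      congrArg ENNReal.toReal (he.measure_preimage_equiv Set.univ)
  have hmass : ∫ y, ρ (e.symm y) ∂ν = ∫ x, ρ x ∂μ := he.symm.integral_comp' ρ
  have hle := h (fun y => ρ (e.symm y)) (hρ.comp_measurePreserving he.symm)
    (he.symm.quasiMeasurePreserving.ae hρ01)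
  rw [average_eq, hmass, ← huniv, ← average_eq, ← he.integral_comp'] at hle
  simpa only [Function.comp_apply, e.symm_apply_apply] using hle

theorem average_prod [SFinite μ] [SFinite ν] {f : X × Y → ℝ} (hf : Integrable f (μ.prod ν)) :
    ⨍ z, f z ∂μ.prod ν = ⨍ x, ⨍ y, f (x, y) ∂ν ∂μ := by
  simp only [average_eq, integral_prod f hf, smul_eq_mul, integral_const_mul, mul_inv,
    ← Set.univ_prod_univ, measureReal_prod_prod, mul_assoc]

theorem integrable_mul_of_mem_Icc {ρ w : X → ℝ} (hw : Integrable w μ)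
    (hρ : AEStronglyMeasurable ρ μ) (hρ01 : ∀ᵐ x ∂μ, ρ x ∈ Set.Icc (0 : ℝ) 1) :
    Integrable (fun x => ρ x * w x) μ :=
  hw.bdd_mul hρ (c := 1) <| hρ01.mono fun x hx => by
    simpa only [Real.norm_eq_abs, abs_of_nonneg hx.1] using hx.2

variable [IsFiniteMeasure μ] [NeZero μ] [IsFiniteMeasure ν] [NeZero ν]

-- Integrate the bound for the slices `ρ (x, ·)`; Jensen's inequality for `χ` then turns the
-- average of the bounds into the bound at the average.
theorem AverageLowerBound.prod {u : X → ℝ} {w : Y → ℝ} {φ χ : ℝ → ℝ}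
    (hu : AverageLowerBound μ u φ) (hw : AverageLowerBound ν w χ) (hu0 : 0 ≤ᵐ[μ] u)
    (hui : Integrable u μ) (hwi : Integrable w ν) (hφ : MonotoneOn φ (Set.Icc 0 1))
    (hχ : ConvexOn ℝ (Set.Icc 0 1) χ) (hχc : Continuous χ)
    (hχm : Set.MapsTo χ (Set.Icc 0 1) (Set.Icc 0 1)) :
    AverageLowerBound (μ.prod ν) (fun z => u z.1 * w z.2) (φ ∘ χ) := fun ρ hρ hρ01 => by
  have hρi : Integrable ρ (μ.prod ν) := .of_mem_Icc 0 1 hρ.aemeasurable hρ01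
  have hslice01 : ∀ᵐ x ∂μ, ∀ᵐ y ∂ν, ρ (x, y) ∈ Set.Icc (0 : ℝ) 1 := Measure.ae_ae_of_ae_prod hρ01
  set m : X → ℝ := fun x => ⨍ y, ρ (x, y) ∂ν
  have hm : AEStronglyMeasurable m μ := by
    simp only [m, average_eq, smul_eq_mul]
    exact hρ.integral_prod_right'.const_mul _
  have hm01 : ∀ᵐ x ∂μ, m x ∈ Set.Icc (0 : ℝ) 1 := by
    filter_upwards [hslice01, hρi.prod_right_ae] with x hx hxi
    exact (convex_Icc 0 1).average_mem isClosed_Icc hx hxi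
  have hmi : Integrable m μ := .of_mem_Icc 0 1 hm.aemeasurable hm01
  have hχm01 : ∀ᵐ x ∂μ, χ (m x) ∈ Set.Icc (0 : ℝ) 1 := hm01.mono fun x hx => hχm hx
  have hχmm : AEStronglyMeasurable (fun x => χ (m x)) μ := hχc.comp_aestronglyMeasurable hm
  have hχi : Integrable (fun x => χ (m x)) μ := .of_mem_Icc 0 1 hχmm.aemeasurable hχm01
  have hjensen : χ (⨍ x, m x ∂μ) ≤ ⨍ x, χ (m x) ∂μ :=
    hχ.map_average_le hχc.continuousOn isClosed_Icc hm01 hmi hχi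
  have hρuw := integrable_mul_of_mem_Icc (hui.mul_prod hwi) hρ hρ01
  have hslice : ∀ᵐ x ∂μ, χ (m x) * u x ≤ ∫ y, ρ (x, y) * (u x * w y) ∂ν := by
    filter_upwards [hslice01, hρ.prodMk_left, hu0] with x hx hxm hux
    calc χ (m x) * u x ≤ (∫ y, ρ (x, y) * w y ∂ν) * u x :=
          mul_le_mul_of_nonneg_right (hw _ hxm hx) hux
      _ = ∫ y, ρ (x, y) * (u x * w y) ∂ν := by
          rw [← integral_mul_const]
          simp only [mul_assoc, mul_comm (w _)]
  calc φ (χ (⨍ z, ρ z ∂μ.prod ν)) = φ (χ (⨍ x, m x ∂μ)) := by rw [average_prod hρi]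
    _ ≤ φ (⨍ x, χ (m x) ∂μ) :=
      hφ (hχm ((convex_Icc 0 1).average_mem isClosed_Icc hm01 hmi))
        ((convex_Icc 0 1).average_mem isClosed_Icc hχm01 hχi) hjensen
    _ ≤ ∫ x, χ (m x) * u x ∂μ := hu _ hχmm hχm01
    _ ≤ ∫ x, ∫ y, ρ (x, y) * (u x * w y) ∂ν ∂μ :=
      integral_mono_ae (integrable_mul_of_mem_Icc hui hχmm hχm01) hρuw.integral_prod_left hslice
    _ = ∫ z, ρ z * (u z.1 * w z.2) ∂μ.prod ν := (integral_prod _ hρuw).symm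

theorem convexOn_iterate {s : Set ℝ} {φ : ℝ → ℝ} (hφ : ConvexOn ℝ s φ) (hmono : MonotoneOn φ s)
    (hmaps : Set.MapsTo φ s s) (n : ℕ) : ConvexOn ℝ s φ^[n] := by
  induction n with
  | zero => exact convexOn_id hφ.1
  | succ n ih =>
    rw [Function.iterate_succ']
    exact ⟨hφ.1, fun x hx y hy a b ha hb hab =>
      (hmono (hmaps.iterate n (hφ.1 hx hy ha hb hab))
        (hφ.1 (hmaps.iterate n hx) (hmaps.iterate n hy) ha hb hab) (ih.2 hx hy ha hb hab)).trans
      (hφ.2 (hmaps.iterate n hx) (hmaps.iterate n hy) ha hb hab)⟩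

theorem AverageLowerBound.pi {φ : ℝ → ℝ} (hφ : ConvexOn ℝ (Set.Icc 0 1) φ)
    (hmono : MonotoneOn φ (Set.Icc 0 1)) (hcont : Continuous φ)
    (hmaps : Set.MapsTo φ (Set.Icc 0 1) (Set.Icc 0 1)) {n : ℕ} {u : Fin n → X → ℝ}
    (hu : ∀ k, AverageLowerBound μ (u k) φ) (hu0 : ∀ k, 0 ≤ᵐ[μ] u k)
    (hui : ∀ k, Integrable (u k) μ) :
    AverageLowerBound (Measure.pi fun _ => μ) (fun x => ∏ k, u k (x k)) φ^[n] := by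
  induction n with
  | zero =>
    rw [Measure.pi_of_empty]
    simpa only [Finset.univ_eq_empty, Finset.prod_empty, Function.iterate_zero] using
      averageLowerBound_one_id
  | succ n ih =>
    have : NeZero (Measure.pi fun _ : Fin n => μ) := ⟨by
      rw [← Measure.measure_univ_ne_zero, Measure.pi_univ, Finset.prod_ne_zero_iff]
      exact fun _ _ => Measure.measure_univ_ne_zero.2 (NeZero.ne μ)⟩
    have hprod := (hu 0).prod (ih (fun k => hu k.succ) (fun k => hu0 k.succ) fun k => hui k.succ)
      (hu0 0) (hui 0) (.fintype_prod fun k => hui k.succ) hmono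
      (convexOn_iterate hφ hmono hmaps n) (hcont.iterate n) (hmaps.iterate n)
    rw [Function.iterate_succ']
    convert hprod.comp_measurePreserving (measurePreserving_piFinSuccAbove (fun _ => μ) 0) using 1
    funext x
    simp only [Fin.prod_univ_succ, Function.comp_apply]
    rfl

end AverageLowerBound

section SineStep

/-- The function `f(u) = F(π u) = u - sin(π u)/π`, whose iterates are the bounds
`sineLowerBound`. -/
noncomputable abbrev sineStep (u : ℝ) : ℝ := sineGap (Real.pi * u)

theorem continuous_sineStep : Continuous sineStep := by
  unfold sineStep sineGap
  fun_prop

theorem monotone_sineGap : Monotone sineGap := fun s t hst => by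
  have h := Real.lipschitzWith_sin.dist_le_mul t s
  rw [NNReal.coe_one, one_mul, Real.dist_eq, Real.dist_eq, abs_of_nonneg (sub_nonneg.2 hst)] at h
  unfold sineGap
  gcongr ?_ / _
  linarith [le_of_abs_le h]

theorem monotone_sineStep : Monotone sineStep :=
  monotone_sineGap.comp (monotone_mul_left_of_nonneg Real.pi_pos.le)

theorem sineStep_zero : sineStep 0 = 0 := by
  simp only [sineStep, sineGap, mul_zero, Real.sin_zero, sub_zero, zero_div]

theorem sineStep_one : sineStep 1 = 1 := by
  simp only [sineStep, sineGap, mul_one, Real.sin_pi, sub_zero, div_self Real.pi_ne_zero]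

theorem sineStep_pos {u : ℝ} (hu : 0 < u) : 0 < sineStep u :=
  div_pos (sub_pos.2 (Real.sin_lt (mul_pos Real.pi_pos hu))) Real.pi_pos

theorem mapsTo_sineStep : Set.MapsTo sineStep (Set.Icc 0 1) (Set.Icc 0 1) := fun _ hu =>
  ⟨sineStep_zero ▸ monotone_sineStep hu.1, sineStep_one ▸ monotone_sineStep hu.2⟩

theorem convexOn_sineStep : ConvexOn ℝ (Set.Icc 0 1) sineStep := by
  have hgap : ConvexOn ℝ (Set.Icc 0 Real.pi) fun s => Real.pi⁻¹ • (s - Real.sin s) :=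
    ((convexOn_id (convex_Icc 0 Real.pi)).sub strictConcaveOn_sin_Icc.concaveOn).smul
      (inv_nonneg.2 Real.pi_pos.le)
  have hpre := hgap.comp_linearMap (LinearMap.mul ℝ ℝ Real.pi)
  refine (hpre.subset (fun u hu => ?_) (convex_Icc 0 1)).congr fun u _ => ?_
  · exact ⟨mul_nonneg Real.pi_pos.le hu.1, mul_le_of_le_one_right Real.pi_pos.le hu.2⟩
  · simp only [Function.comp_apply, LinearMap.mul_apply', smul_eq_mul, sineStep, sineGap,
      inv_mul_eq_div]

theorem sineLowerBound_pos (n : ℕ) {s : ℝ} (hs : 0 < s) : 0 < sineLowerBound n s :=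
  Set.MapsTo.iterate (s := Set.Ioi 0) (fun _ hu => sineStep_pos hu) n
    (div_pos hs (pow_pos Real.pi_pos n))

end SineStep

section SineWeight

theorem integral_comp_cos_two_mul {h : ℝ → ℝ} (hh : Continuous h) (j : ℕ+) :
    ∫ x in 0..Real.pi, h (Real.cos (2 * j * x)) = ∫ x in 0..Real.pi, h (Real.cos x) := by
  have hj : (0 : ℝ) < j := Nat.cast_pos.2 j.pos
  have hint : ∀ a b, IntervalIntegrable (fun x => h (Real.cos x)) volume a b :=
    (hh.comp Real.continuous_cos).intervalIntegrable
  have hper : Function.Periodic (fun x => h (Real.cos x)) (2 * Real.pi) :=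
    Real.cos_periodic.comp h
  have heven : ∫ x in -Real.pi..0, h (Real.cos x) = ∫ x in 0..Real.pi, h (Real.cos x) := by
    simpa only [Real.cos_neg, neg_zero, neg_neg] using
      (intervalIntegral.integral_comp_neg (a := 0) (b := Real.pi) fun x => h (Real.cos x)).symm
  have hperiods : ∫ x in 0..2 * j * Real.pi, h (Real.cos x) =
      j * ∫ x in -Real.pi..Real.pi, h (Real.cos x) := by
    have hshift := hper.intervalIntegral_add_eq 0 (-Real.pi)
    have hmul := hper.intervalIntegral_add_zsmul_eq j 0 hint
    have hend : 0 + ((j : ℕ) : ℤ) • (2 * Real.pi) = 2 * j * Real.pi := by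
      simp only [zero_add, natCast_zsmul, nsmul_eq_mul]
      ring
    have hright : -Real.pi + 2 * Real.pi = Real.pi := by ring
    rwa [hshift, hend, hright, natCast_zsmul, nsmul_eq_mul] at hmul
  rw [intervalIntegral.integral_comp_mul_left (fun x => h (Real.cos x))
      (mul_pos two_pos hj).ne', mul_zero, hperiods,
    ← intervalIntegral.integral_add_adjacent_intervals (hint _ 0) (hint _ _), heven, smul_eq_mul]
  field_simp
  ring

theorem integral_max_cos_sub_zero {s : ℝ} (hs : s ∈ Set.Icc 0 Real.pi) :
    ∫ x in 0..Real.pi, max (Real.cos x - Real.cos s) 0 = Real.sin s - s * Real.cos s := by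
  have hint : ∀ a b, IntervalIntegrable (fun x => max (Real.cos x - Real.cos s) 0) volume a b :=
    Continuous.intervalIntegrable (by fun_prop)
  have hleft : ∫ x in 0..s, max (Real.cos x - Real.cos s) 0 =
      ∫ x in 0..s, Real.cos x - Real.cos s :=
    intervalIntegral.integral_congr fun x hx => by
      rw [Set.uIcc_of_le hs.1] at hx
      exact max_eq_left (sub_nonneg.2 (Real.cos_le_cos_of_nonneg_of_le_pi hx.1 hs.2 hx.2))
  have hright : ∫ x in s..Real.pi, max (Real.cos x - Real.cos s) 0 = ∫ x in s..Real.pi, 0 :=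
    intervalIntegral.integral_congr fun x hx => by
      rw [Set.uIcc_of_le hs.2] at hx
      exact max_eq_right (sub_nonpos.2 (Real.cos_le_cos_of_nonneg_of_le_pi hs.1 hx.2 hx.1))
  rw [← intervalIntegral.integral_add_adjacent_intervals (hint _ s) (hint _ _), hleft, hright,
    intervalIntegral.integral_sub (by simp) (by simp)]
  simp

variable {ρ : ℝ → ℝ}

-- The density `𝟙 {cos (2 j x) > cos s}` of mass `s` is extremal, and attains equality.
theorem setIntegral_mul_cos_two_mul_le (j : ℕ+)
    (hρ : AEStronglyMeasurable ρ (volume.restrict (Set.Ioo 0 Real.pi)))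
    (hρ01 : ∀ᵐ x ∂volume.restrict (Set.Ioo 0 Real.pi), ρ x ∈ Set.Icc (0 : ℝ) 1) :
    ∫ x in Set.Ioo 0 Real.pi, ρ x * Real.cos (2 * j * x) ≤
      Real.sin (∫ x in Set.Ioo 0 Real.pi, ρ x) := by
  set s := ∫ x in Set.Ioo 0 Real.pi, ρ x
  have hρi : IntegrableOn ρ (Set.Ioo 0 Real.pi) := .of_mem_Icc 0 1 hρ.aemeasurable hρ01
  have hint {h : ℝ → ℝ} (hh : Continuous h) : IntegrableOn h (Set.Ioo 0 Real.pi) :=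
    (hh.integrableOn_Icc).mono_set Set.Ioo_subset_Icc_self
  have hs : s ∈ Set.Icc 0 Real.pi := by
    refine ⟨integral_nonneg_of_ae (hρ01.mono fun x hx => hx.1), ?_⟩
    simpa [Real.pi_pos.le] using
      integral_mono_ae hρi (integrable_const 1) (hρ01.mono fun x hx => hx.2)
  have hpos : ∫ x in Set.Ioo 0 Real.pi, max (Real.cos (2 * j * x) - Real.cos s) 0 =
      Real.sin s - s * Real.cos s := by
    rw [← integral_max_cos_sub_zero hs, ← integral_comp_cos_two_mul
      (h := fun c => max (c - Real.cos s) 0) (by fun_prop) j,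
      intervalIntegral.integral_of_le Real.pi_pos.le, integral_Ioc_eq_integral_Ioo]
  have hle : ∀ᵐ x ∂volume.restrict (Set.Ioo 0 Real.pi), ρ x * Real.cos (2 * j * x) ≤
      max (Real.cos (2 * j * x) - Real.cos s) 0 + Real.cos s * ρ x := by
    filter_upwards [hρ01] with x hx
    have hmax : ρ x * (Real.cos (2 * j * x) - Real.cos s) ≤
        max (Real.cos (2 * j * x) - Real.cos s) 0 :=
      (mul_le_mul_of_nonneg_left (le_max_left _ 0) hx.1).trans
        (mul_le_of_le_one_left (le_max_right _ _) hx.2)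
    linarith
  calc ∫ x in Set.Ioo 0 Real.pi, ρ x * Real.cos (2 * j * x)
      ≤ ∫ x in Set.Ioo 0 Real.pi,
          (max (Real.cos (2 * j * x) - Real.cos s) 0 + Real.cos s * ρ x) :=
        integral_mono_ae (integrable_mul_of_mem_Icc (hint (by fun_prop)) hρ hρ01)
          ((hint (by fun_prop)).add (hρi.const_mul _)) hle
    _ = Real.sin s := by
        rw [integral_add (hint (by fun_prop)) (hρi.const_mul _), hpos, integral_const_mul]
        ring

/-- The one-dimensional factor `(2/π) sin²(j x)` of the square of a mode. -/
noncomputable abbrev sineWeight (j : ℕ+) (x : ℝ) : ℝ := 2 / Real.pi * Real.sin (j * x) ^ 2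

theorem sineWeight_eq (j : ℕ+) (x : ℝ) :
    sineWeight j x = (1 - Real.cos (2 * j * x)) / Real.pi := by
  rw [sineWeight, Real.sin_sq_eq_half_sub, mul_assoc]
  ring

theorem integrableOn_sineWeight (j : ℕ+) : IntegrableOn (sineWeight j) (Set.Ioo 0 Real.pi) :=
  (Continuous.integrableOn_Icc (by fun_prop)).mono_set Set.Ioo_subset_Icc_self

theorem setIntegral_sineWeight (j : ℕ+) : ∫ x in Set.Ioo 0 Real.pi, sineWeight j x = 1 := by
  simp only [sineWeight_eq]
  rw [← integral_Ioc_eq_integral_Ioo, ← intervalIntegral.integral_of_le Real.pi_pos.le,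
    integral_comp_cos_two_mul (h := fun c => (1 - c) / Real.pi) (by fun_prop) j]
  simp [Real.pi_ne_zero]

theorem averageLowerBound_sineWeight (j : ℕ+) :
    AverageLowerBound (volume.restrict (Set.Ioo 0 Real.pi)) (sineWeight j) sineStep :=
  fun ρ hρ hρ01 => by
  have hρi : IntegrableOn ρ (Set.Ioo 0 Real.pi) := .of_mem_Icc 0 1 hρ.aemeasurable hρ01
  have hcos : IntegrableOn (fun x => ρ x * Real.cos (2 * j * x)) (Set.Ioo 0 Real.pi) :=
    integrable_mul_of_mem_Icc
      ((Continuous.integrableOn_Icc (by fun_prop)).mono_set Set.Ioo_subset_Icc_self) hρ hρ01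
  have hmass : Real.pi * ⨍ x in Set.Ioo 0 Real.pi, ρ x = ∫ x in Set.Ioo 0 Real.pi, ρ x := by
    rw [setAverage_eq, Real.volume_real_Ioo_of_le Real.pi_pos.le, sub_zero, smul_eq_mul,
      mul_inv_cancel_left₀ Real.pi_ne_zero]
  have hsplit : ∫ x in Set.Ioo 0 Real.pi, ρ x * sineWeight j x =
      ((∫ x in Set.Ioo 0 Real.pi, ρ x) -
        ∫ x in Set.Ioo 0 Real.pi, ρ x * Real.cos (2 * j * x)) / Real.pi := by
    simp only [sineWeight_eq, mul_div_assoc', mul_one_sub, integral_div]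
    rw [integral_sub hρi hcos]
  rw [sineStep, hmass, hsplit, sineGap]
  gcongr
  exact setIntegral_mul_cos_two_mul_le j hρ hρ01

end SineWeight

section Modes

variable {n : ℕ}

theorem sineMode_sq (j : Fin n → ℕ+) (x : Fin n → ℝ) :
    sineMode j x ^ 2 = ∏ k, sineWeight (j k) (x k) := by
  have hconst : ((2 / Real.pi) ^ ((n : ℝ) / 2)) ^ 2 = (2 / Real.pi) ^ n := by
    rw [← Real.rpow_mul_natCast (by positivity), Nat.cast_ofNat, div_mul_cancel₀ _ two_ne_zero,
      Real.rpow_natCast]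
  rw [sineMode, mul_pow, hconst, Finset.prod_mul_distrib, Finset.prod_pow, Finset.prod_const,
    Finset.card_univ, Fintype.card_fin]

theorem isOpen_orthotope (n : ℕ) : IsOpen (orthotope n) :=
  isOpen_set_pi Set.finite_univ fun _ _ => isOpen_Ioo

theorem volume_restrict_orthotope (n : ℕ) :
    volume.restrict (orthotope n) = Measure.pi fun _ => volume.restrict (Set.Ioo 0 Real.pi) := by
  rw [orthotope, volume_pi, Measure.restrict_pi_pi]

theorem volume_orthotope (n : ℕ) : volume (orthotope n) = ENNReal.ofReal (Real.pi ^ n) := by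
  simp [orthotope, volume_pi_pi, ENNReal.ofReal_pow Real.pi_pos.le]

theorem volume_real_orthotope (n : ℕ) : volume.real (orthotope n) = Real.pi ^ n := by
  rw [measureReal_def, volume_orthotope, ENNReal.toReal_ofReal (pow_pos Real.pi_pos n).le]

theorem integrableOn_sineMode_sq (j : Fin n → ℕ+) :
    IntegrableOn (fun x => sineMode j x ^ 2) (orthotope n) := by
  rw [IntegrableOn, volume_restrict_orthotope]
  simp only [sineMode_sq]
  exact .fintype_prod fun k => integrableOn_sineWeight (j k)

theorem setIntegral_sineMode_sq (j : Fin n → ℕ+) : ∫ x in orthotope n, sineMode j x ^ 2 = 1 := by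
  rw [volume_restrict_orthotope]
  simp only [sineMode_sq, integral_fintype_prod_eq_prod (fun k => sineWeight (j k)),
    setIntegral_sineWeight, Finset.prod_const_one]

theorem setIntegral_sineMode_sq_le_one (j : Fin n → ℕ+) {ω : Set (Fin n → ℝ)}
    (hω : ω ⊆ orthotope n) : ∫ x in ω, sineMode j x ^ 2 ≤ 1 :=
  (setIntegral_mono_set (integrableOn_sineMode_sq j) (ae_of_all _ fun _ => sq_nonneg _)
    hω.eventuallyLE).trans (setIntegral_sineMode_sq j).le

theorem averageLowerBound_sineMode_sq (j : Fin n → ℕ+) :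
    AverageLowerBound (volume.restrict (orthotope n)) (fun x => sineMode j x ^ 2) sineStep^[n] := by
  have : NeZero (volume.restrict (Set.Ioo 0 Real.pi)) := ⟨by simp [Real.pi_pos]⟩
  rw [volume_restrict_orthotope]
  simp only [sineMode_sq]
  exact .pi convexOn_sineStep (monotone_sineStep.monotoneOn _) continuous_sineStep mapsTo_sineStep
    (fun k => averageLowerBound_sineWeight (j k)) (fun k => ae_of_all _ fun x => by positivity)
    fun k => integrableOn_sineWeight (j k)

theorem sineLowerBound_setIntegral_le {ρ : (Fin n → ℝ) → ℝ} (hρ : IsDensity n ρ)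
    (j : Fin n → ℕ+) :
    sineLowerBound n (∫ x in orthotope n, ρ x) ≤ ∫ x in orthotope n, ρ x * sineMode j x ^ 2 := by
  have hbound := averageLowerBound_sineMode_sq j ρ hρ.1 hρ.2
  rwa [setAverage_eq, volume_real_orthotope, smul_eq_mul, inv_mul_eq_div] at hbound

end Modes

section Weights

theorem timeWeight_eq_integral (l T : ℝ) :
    timeWeight l T = ∫ t in 0..T, Real.exp (2 * l * t) := by
  rcases eq_or_ne l 0 with rfl | hl
  · simp [timeWeight]
  · rw [timeWeight, if_neg hl, intervalIntegral.integral_comp_mul_left _ (by positivity),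
      integral_exp, mul_zero, Real.exp_zero, smul_eq_mul, inv_mul_eq_div]

theorem monotone_timeWeight {T : ℝ} (hT : 0 ≤ T) : Monotone fun l => timeWeight l T :=
  fun l l' hl => by
  simp only [timeWeight_eq_integral]
  refine intervalIntegral.integral_mono_on hT (Continuous.intervalIntegrable (by fun_prop) _ _)
    (Continuous.intervalIntegrable (by fun_prop) _ _) fun t ht => ?_
  have := ht.1
  gcongr

theorem add_mul_sq_le_timeWeight (l : ℝ) {T : ℝ} (hT : 0 ≤ T) : T + l * T ^ 2 ≤ timeWeight l T :=
  calc T + l * T ^ 2 = ∫ t in 0..T, (1 + 2 * l * t) := by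
        rw [intervalIntegral.integral_add (by simp)
            (Continuous.intervalIntegrable (by fun_prop) _ _),
          intervalIntegral.integral_const_mul, intervalIntegral.integral_const, integral_id]
        simp only [smul_eq_mul]
        ring
    _ ≤ ∫ t in 0..T, Real.exp (2 * l * t) :=
        intervalIntegral.integral_mono_on hT (Continuous.intervalIntegrable (by fun_prop) _ _)
          (Continuous.intervalIntegrable (by fun_prop) _ _) fun t _ => by
            rw [add_comm]
            exact Real.add_one_le_exp _
    _ = timeWeight l T := (timeWeight_eq_integral l T).symm

theorem tendsto_timeWeight_atTop {T : ℝ} (hT : 0 < T) :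
    Tendsto (fun l => timeWeight l T) atTop atTop :=
  tendsto_atTop_mono (fun l => add_mul_sq_le_timeWeight l hT.le)
    (tendsto_const_nhds.add_atTop (tendsto_id.atTop_mul_const (by positivity)))

variable {n : ℕ} {α T : ℝ}

theorem modeEigenvalue_nonneg (α : ℝ) (j : Fin n → ℕ+) : 0 ≤ modeEigenvalue α j :=
  Real.rpow_nonneg (Finset.sum_nonneg fun _ _ => sq_nonneg _) α

theorem modeWeight_pos (hT : 0 < T) (j : Fin n → ℕ+) : 0 < modeWeight α T j := by
  have := modeEigenvalue_nonneg α j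
  exact lt_of_lt_of_le (by positivity) (add_mul_sq_le_timeWeight _ hT.le)

theorem tendsto_modeEigenvalue_cofinite (hα : 0 < α) :
    Tendsto (fun j : Fin n → ℕ+ => modeEigenvalue α j) cofinite atTop := by
  refine (tendsto_rpow_atTop hα).comp (tendsto_atTop.2 fun c => eventually_cofinite.2 ?_)
  refine (Set.finite_Iic fun _ => ⌈c⌉₊.succPNat).subset fun j hj k => ?_
  have hk : (j k : ℝ) ≤ ∑ i, (j i : ℝ) ^ 2 :=
    (le_self_pow₀ (Nat.one_le_cast.2 (j k).pos) two_ne_zero).trans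
      (Finset.single_le_sum (f := fun i => (j i : ℝ) ^ 2) (fun _ _ => sq_nonneg _)
        (Finset.mem_univ k))
  have hc : (j k : ℝ) ≤ ⌈c⌉₊ := hk.trans ((not_le.1 hj).le.trans (Nat.le_ceil c))
  exact (Nat.cast_le.1 hc).trans (Nat.le_succ _)

theorem tendsto_modeWeight_cofinite (hα : 0 < α) (hT : 0 < T) :
    Tendsto (modeWeight (n := n) α T) cofinite atTop :=
  (tendsto_timeWeight_atTop hT).comp (tendsto_modeEigenvalue_cofinite hα)

theorem spectralH2 (hα : 0 < α) (hT : 0 < T) {L : ℝ} (hL : 0 < L) : SpectralH2 n α T L := by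
  intro a ha hmass
  set c := modeWeight α T fun _ : Fin n => (1 : ℕ+)
  have hpos : 0 < sineLowerBound n (∫ x in orthotope n, a x) := by
    rw [hmass, volume_real_orthotope]
    exact sineLowerBound_pos n (mul_pos hL (pow_pos Real.pi_pos n))
  have hlarge : ∀ᶠ j in cofinite, ((c + 1 : ℝ) : EReal) ≤
      ((modeWeight α T j * ∫ x in orthotope n, a x * sineMode j x ^ 2 : ℝ) : EReal) := by
    filter_upwards [((tendsto_modeWeight_cofinite hα hT).atTop_mul_const hpos).eventually_ge_atTop
      (c + 1)] with j hj
    exact EReal.coe_le_coe_iff.2 (hj.trans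
      (mul_le_mul_of_nonneg_left (sineLowerBound_setIntegral_le ha j) (modeWeight_pos hT j).le))
  exact (EReal.coe_lt_coe_iff.2 (lt_add_one c)).trans_le
    (le_liminf_of_le (by isBoundedDefault) hlarge)

end Weights

section Enumeration

theorem nonempty_orderIso_nat_of_finite_Iio {J : Type*} [LinearOrder J] [Infinite J]
    (h : ∀ j : J, (Set.Iio j).Finite) : Nonempty (ℕ ≃o J) := by
  have hrank : StrictMono fun j : J => (Set.Iio j).ncard := fun i j hij =>
    Set.ncard_lt_ncard (Set.Iio_ssubset_Iio hij) (h j)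
  have := (Set.infinite_range_of_injective hrank.injective).to_subtype
  classical
  exact ⟨(Nat.Subtype.orderIsoOfNat _).trans (hrank.orderIso _).symm⟩

-- Ties of `f` are broken by an arbitrary well-order of `J`.
theorem exists_pnat_equiv_monotone_comp {J β : Type*} [Infinite J] [LinearOrder β] {f : J → β}
    (hf : ∀ c, {j | f j ≤ c}.Finite) : ∃ σ : ℕ+ ≃ J, Monotone (f ∘ σ) := by
  classical
  let tieBreak : LinearOrder J := linearOrderOfSTO WellOrderingRel
  let key : J → β ×ₗ J := fun j => toLex (f j, j)
  have hkey : Function.Injective key := fun i j h => congrArg (fun p => (ofLex p).2) h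
  have hmono : ∀ {i j}, key i ≤ key j → f i ≤ f j := Prod.Lex.monotone_fst _ _
  have hmono_lt : ∀ {i j}, key i < key j → f i ≤ f j := fun h => hmono h.le
  let order : LinearOrder J := LinearOrder.lift' key hkey
  obtain ⟨e⟩ := @nonempty_orderIso_nat_of_finite_Iio J order _ fun j =>
    (hf (f j)).subset fun i hi => hmono_lt hi
  exact ⟨(OrderIso.pnatIsoNat.trans e).toEquiv, fun i j hij =>
    hmono ((OrderIso.pnatIsoNat.trans e).monotone hij)⟩

theorem exists_isOrderedEnumeration {n : ℕ} (hn : 1 ≤ n) {α : ℝ} (hα : 0 < α) :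
    ∃ σ : ℕ+ ≃ (Fin n → ℕ+), IsOrderedEnumeration α σ := by
  have : Nonempty (Fin n) := ⟨⟨0, hn⟩⟩
  refine exists_pnat_equiv_monotone_comp (f := modeEigenvalue α) fun c => ?_
  simpa only [not_lt] using eventually_cofinite.1
    ((tendsto_modeEigenvalue_cofinite (n := n) hα).eventually_gt_atTop c)

end Enumeration

section Admissible

variable {n : ℕ} {L : ℝ} {ω : Set (Fin n → ℝ)}

theorem mem_admissibleSets_iff (hL : 0 ≤ L) :
    ω ∈ admissibleSets n L ↔
      ω ⊆ orthotope n ∧ NullMeasurableSet ω volume ∧ volume.real ω = L * Real.pi ^ n := by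
  refine and_congr_right fun hω => and_congr_right fun _ => ?_
  have hω_top : volume ω ≠ ⊤ := measure_ne_top_of_subset hω (volume_orthotope n ▸ by simp)
  rw [volume_orthotope, ← ENNReal.ofReal_mul hL, measureReal_def,
    ← ENNReal.toReal_eq_toReal_iff' hω_top ENNReal.ofReal_ne_top,
    ENNReal.toReal_ofReal (mul_nonneg hL (pow_pos Real.pi_pos n).le)]

theorem sineLowerBound_le_setIntegral_sineMode_sq (hL : 0 ≤ L) (hω : ω ∈ admissibleSets n L)
    (j : Fin n → ℕ+) : sineLowerBound n (L * Real.pi ^ n) ≤ ∫ x in ω, sineMode j x ^ 2 := by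
  obtain ⟨hsub, hmeas, hvol⟩ := (mem_admissibleSets_iff hL).1 hω
  have hmeas' : NullMeasurableSet ω (volume.restrict (orthotope n)) :=
    hmeas.mono_ac Measure.restrict_le_self.absolutelyContinuous
  have hrestrict : (volume.restrict (orthotope n)).restrict ω = volume.restrict ω :=
    Measure.restrict_restrict_of_subset hsub
  have hdensity : IsDensity n (ω.indicator 1) :=
    ⟨aestronglyMeasurable_one.indicator₀ hmeas', ae_of_all _ fun x =>
      ⟨Set.indicator_nonneg (fun _ _ => zero_le_one) x,
        Set.indicator_le' (fun _ _ => le_rfl) (fun _ _ => zero_le_one) x⟩⟩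
  have hmass : ∫ x in orthotope n, ω.indicator 1 x = L * Real.pi ^ n := by
    rw [integral_indicator₀ hmeas', hrestrict]
    simp [hvol]
  have hmul : ∫ x in orthotope n, ω.indicator 1 x * sineMode j x ^ 2 =
      ∫ x in ω, sineMode j x ^ 2 := by
    rw [← hrestrict, ← integral_indicator₀ hmeas']
    refine integral_congr_ae (ae_of_all _ fun x => ?_)
    by_cases hx : x ∈ ω <;> simp [hx]
  rw [← hmass, ← hmul]
  exact sineLowerBound_setIntegral_le hdensity j

theorem IsUniqueOptimalSet.congr {Φ Ψ : Set (Fin n → ℝ) → ℝ} (h : IsUniqueOptimalSet n L Φ ω)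
    (heq : Set.EqOn Φ Ψ (admissibleSets n L)) : IsUniqueOptimalSet n L Ψ ω := by
  obtain ⟨hω, hmax, huniq⟩ := h
  refine ⟨hω, fun ω' hω' => ?_, fun ω' hω' h => huniq ω' hω' ?_⟩
  · rw [← heq hω', ← heq hω]
    exact hmax ω' hω'
  · rw [heq hω', heq hω, h]

theorem isUniqueOptimalSet_inter_orthotope (hL : 0 ≤ L) {Φ : Set (Fin n → ℝ) → ℝ}
    (hΦ : ∀ S, Φ (S ∩ orthotope n) = Φ S) {S : Set (Fin n → ℝ)}
    (hS : NullMeasurableSet S (volume.restrict (orthotope n)))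
    (hvol : (volume.restrict (orthotope n)).real S = L * Real.pi ^ n)
    (hmax : ∀ S', NullMeasurableSet S' (volume.restrict (orthotope n)) →
      (volume.restrict (orthotope n)).real S' = (volume.restrict (orthotope n)).real S →
        Φ S' ≤ Φ S ∧ (Φ S' = Φ S → S' =ᵐ[volume.restrict (orthotope n)] S)) :
    IsUniqueOptimalSet n L Φ (S ∩ orthotope n) := by
  have hΩ := (isOpen_orthotope n).measurableSet
  have hmax' : ∀ ω ∈ admissibleSets n L, ω ⊆ orthotope n ∧ Φ ω ≤ Φ S ∧
      (Φ ω = Φ S → ω =ᵐ[volume.restrict (orthotope n)] S) := fun ω hω => by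
    obtain ⟨hsub, hmeas, hω_vol⟩ := (mem_admissibleSets_iff hL).1 hω
    refine ⟨hsub, hmax ω (hmeas.mono_ac Measure.restrict_le_self.absolutelyContinuous) ?_⟩
    rw [hvol, ← hω_vol, measureReal_restrict_apply' hΩ, Set.inter_eq_left.2 hsub]
  refine ⟨(mem_admissibleSets_iff hL).2 ⟨Set.inter_subset_right,
    (nullMeasurableSet_restrict hΩ.nullMeasurableSet).1 hS,
    (measureReal_restrict_apply' hΩ).symm.trans hvol⟩, fun ω hω => ?_, fun ω hω h => ?_⟩
  · rw [hΦ]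
    exact (hmax' ω hω).2.1
  · obtain ⟨hsub, -, huniq⟩ := hmax' ω hω
    have hae := (ae_restrict_iff' hΩ).1 (huniq (h.trans (hΦ S))).mem_iff
    exact eventuallyEq_set.2 (hae.mono fun x hx =>
      ⟨fun hxω => ⟨(hx (hsub hxω)).1 hxω, hsub hxω⟩, fun hxS => (hx hxS.2).2 hxS.1⟩)

theorem exists_isUniqueOptimalSet_superlevel {ι : Type*} [Fintype ι] [Nonempty ι]
    {g : ι → (Fin n → ℝ) → ℝ} (hg : ∀ i, IntegrableOn (g i) (orthotope n))
    (hlev : ∀ b ∈ stdSimplex ℝ ι, ∀ ξ, volume {x | ∑ i, b i * g i x = ξ} = 0)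
    (hL : L ∈ Set.Ioo (0 : ℝ) 1) :
    ∃ b ∈ stdSimplex ℝ ι, ∃ ξ, IsUniqueOptimalSet n L (fun ω => ⨅ i, ∫ x in ω, g i x)
      ({x | ξ < ∑ i, b i * g i x} ∩ orthotope n) := by
  have hΩ := (isOpen_orthotope n).measurableSet
  have hπ := pow_pos Real.pi_pos n
  have : IsFiniteMeasure (volume.restrict (orthotope n)) := ⟨by simp [volume_orthotope]⟩
  have hlev' : ∀ b ∈ stdSimplex ℝ ι, ∀ ξ,
      volume.restrict (orthotope n) {x | ∑ i, b i * g i x = ξ} = 0 := fun b hb ξ =>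
    Measure.restrict_le_self.absolutelyContinuous (hlev b hb ξ)
  have hmass : L * Real.pi ^ n ∈ Set.Ioo 0 ((volume.restrict (orthotope n)).real Set.univ) := by
    rw [measureReal_restrict_apply_univ, volume_real_orthotope]
    exact ⟨mul_pos hL.1 hπ, mul_lt_of_lt_one_left hπ hL.2⟩
  obtain ⟨b, hb, ξ, hvol, hbal⟩ := exists_superlevel_forall_setIntegral_le hg hlev' hmass
  have hmeas : NullMeasurableSet {x | ξ < ∑ i, b i * g i x} (volume.restrict (orthotope n)) :=
    nullMeasurableSet_lt aemeasurable_const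
      (integrable_finsetSum _ fun i _ => (hg i).const_mul (b i)).aemeasurable
  refine ⟨b, hb, ξ, IsUniqueOptimalSet.congr
    (Φ := fun ω => ⨅ i, ∫ x in ω, g i x ∂volume.restrict (orthotope n))
    (isUniqueOptimalSet_inter_orthotope hL.1.le (fun S => ?_) hmeas hvol fun S hS hS_vol =>
      ⟨iInf_setIntegral_le_iInf_setIntegral_superlevel hg hb hbal hS hS_vol,
        ae_eq_superlevel_of_iInf_setIntegral_eq hg hb (hlev' b hb ξ) hbal hS hS_vol⟩)
    fun ω hω => ?_⟩
  · simp only [Measure.restrict_restrict' hΩ, Set.inter_assoc, Set.inter_self]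
  · simp only [Measure.restrict_restrict_of_subset hω.1]

end Admissible

section Analytic

variable {n : ℕ}

theorem analyticOnNhd_sineMode (j : Fin n → ℕ+) : AnalyticOnNhd ℝ (sineMode j) Set.univ :=
  analyticOnNhd_const.mul (Finset.analyticOnNhd_fun_prod _ fun k _ x _ =>
    Real.analyticAt_sin.comp
      (analyticAt_const.mul (ContinuousLinearMap.analyticAt (.proj (R := ℝ) k) x)))

theorem sineMode_zero (hn : 1 ≤ n) (j : Fin n → ℕ+) : sineMode j 0 = 0 := by
  rw [sineMode, Finset.prod_eq_zero (Finset.mem_univ ⟨0, hn⟩) (by simp), mul_zero]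

theorem exists_sineMode_ne_zero (j : Fin n → ℕ+) : ∃ x, sineMode j x ≠ 0 := by
  by_contra! h
  simpa [h] using setIntegral_sineMode_sq j

theorem analyticOnNhd_sum_mul_sineMode_sq {ι : Type*} [Fintype ι] (e : ι → Fin n → ℕ+)
    (c : ι → ℝ) : AnalyticOnNhd ℝ (fun x => ∑ i, c i * sineMode (e i) x ^ 2) Set.univ :=
  Finset.analyticOnNhd_fun_sum _ fun i _ =>
    analyticOnNhd_const.mul ((analyticOnNhd_sineMode (e i)).pow 2)

theorem volume_setOf_sum_mul_sineMode_sq_eq (hn : 1 ≤ n) {ι : Type*} [Fintype ι]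
    (e : ι → Fin n → ℕ+) {c : ι → ℝ} (hc : 0 < c) (ξ : ℝ) :
    volume {x | ∑ i, c i * sineMode (e i) x ^ 2 = ξ} = 0 := by
  obtain ⟨x, hx⟩ : ∃ x, ∑ i, c i * sineMode (e i) x ^ 2 ≠ ξ := by
    obtain ⟨hc_nonneg, i, hi⟩ := Pi.lt_def.1 hc
    rcases eq_or_ne ξ 0 with rfl | hξ
    · obtain ⟨x, hx⟩ := exists_sineMode_ne_zero (e i)
      exact ⟨x, (Finset.sum_pos' (fun k _ => mul_nonneg (hc_nonneg k) (sq_nonneg _))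
        ⟨i, Finset.mem_univ i, mul_pos hi (by positivity)⟩).ne'⟩
    · exact ⟨0, by simpa [sineMode_zero hn] using hξ.symm⟩
  have hae := ae_ne_zero_of_analyticOnNhd volume
    ((analyticOnNhd_sum_mul_sineMode_sq e c).sub (analyticOnNhd_const (v := ξ))) (x := x)
    (sub_ne_zero.2 hx)
  simpa [ae_iff, sub_eq_zero] using hae

theorem isSemiAnalytic_setOf_forall_pos {E ι : Type*} [NormedAddCommGroup E] [NormedSpace ℝ E]
    [Finite ι] {g : ι → E → ℝ} (hg : ∀ i, AnalyticOnNhd ℝ (g i) Set.univ) :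
    IsSemiAnalytic {y | ∀ i, 0 < g i y} := by
  obtain ⟨r, ⟨e⟩⟩ := Finite.exists_equiv_fin ι
  refine fun x => ⟨Set.univ, isOpen_univ, Set.mem_univ x, 1, 0, r, fun _ k => k.elim0,
    fun _ k => g (e.symm k), fun _ k => k.elim0, fun _ k => hg _, ?_⟩
  ext y
  simp [e.symm.forall_congr_left]

theorem isSemiAnalytic_superlevel_inter_orthotope {ψ : (Fin n → ℝ) → ℝ}
    (hψ : AnalyticOnNhd ℝ ψ Set.univ) (ξ : ℝ) :
    IsSemiAnalytic ({x | ξ < ψ x} ∩ orthotope n) := by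
  have hcoord : ∀ k, AnalyticOnNhd ℝ (fun x : Fin n → ℝ => x k) Set.univ := fun k x _ =>
    ContinuousLinearMap.analyticAt (.proj (R := ℝ) k) x
  have hset : {x | ξ < ψ x} ∩ orthotope n = {x : Fin n → ℝ | ∀ i : Option (Fin n ⊕ Fin n),
      0 < i.elim (ψ x - ξ) (Sum.elim x fun k => Real.pi - x k)} := by
    ext x
    simp [orthotope, Option.forall, forall_and]
  rw [hset]
  exact isSemiAnalytic_setOf_forall_pos (Option.forall.2 ⟨hψ.sub analyticOnNhd_const,
    Sum.forall.2 ⟨hcoord, fun k => analyticOnNhd_const.sub (hcoord k)⟩⟩)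

end Analytic

section Optimal

variable {n : ℕ} {α T L : ℝ} {σ : ℕ+ ≃ (Fin n → ℕ+)} {N : ℕ+}

theorem exists_isUniqueOptimalSet_iInf_mul_sineMode_sq (hn : 1 ≤ n) (hL : L ∈ Set.Ioo (0 : ℝ) 1)
    {ι : Type*} [Finite ι] [Nonempty ι] (e : ι → Fin n → ℕ+) {w : ι → ℝ} (hw : ∀ i, 0 < w i) :
    ∃ ω, IsOpen ω ∧ IsSemiAnalytic ω ∧
      IsUniqueOptimalSet n L (fun ω => ⨅ i, w i * ∫ x in ω, sineMode (e i) x ^ 2) ω := by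
  have := Fintype.ofFinite ι
  have hlev : ∀ b ∈ stdSimplex ℝ ι, ∀ ξ,
      volume {x | ∑ i, b i * (w i * sineMode (e i) x ^ 2) = ξ} = 0 := fun b hb ξ => by
    have hb_ne : b ≠ 0 := by
      rintro rfl
      simpa using hb.2
    obtain ⟨i, hi⟩ := Function.ne_iff.1 hb_ne
    have hbw : 0 < b * w := Pi.lt_def.2 ⟨fun k => mul_nonneg (hb.1 k) (hw k).le, i,
      mul_pos ((hb.1 i).lt_of_ne' hi) (hw i)⟩
    simpa only [Pi.mul_apply, mul_assoc] using volume_setOf_sum_mul_sineMode_sq_eq hn e hbw ξ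
  obtain ⟨b, -, ξ, hopt⟩ := exists_isUniqueOptimalSet_superlevel
    (fun i => (integrableOn_sineMode_sq (e i)).const_mul (w i)) hlev hL
  have hψ := analyticOnNhd_sum_mul_sineMode_sq e fun i => b i * w i
  simp only [mul_assoc] at hψ
  simp only [integral_const_mul] at hopt
  exact ⟨_, (isOpen_lt continuous_const (continuousOn_univ.1 hψ.continuousOn)).inter
    (isOpen_orthotope n), isSemiAnalytic_superlevel_inter_orthotope hψ ξ, hopt⟩

theorem exists_isUniqueOptimalSet_truncFunctional (hn : 1 ≤ n) (α : ℝ) (hT : 0 < T)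
    (hL : L ∈ Set.Ioo (0 : ℝ) 1) (σ : ℕ+ ≃ (Fin n → ℕ+)) (N : ℕ+) :
    ∃ ω, IsOpen ω ∧ IsSemiAnalytic ω ∧ IsUniqueOptimalSet n L (truncFunctional α T σ N) ω :=
  exists_isUniqueOptimalSet_iInf_mul_sineMode_sq hn hL (fun i : Set.Iic N => σ i)
    fun i => modeWeight_pos hT (σ i)

theorem monotone_modeWeight_comp (hT : 0 ≤ T) (hσ : IsOrderedEnumeration α σ) :
    Monotone fun i => modeWeight α T (σ i) :=
  (monotone_timeWeight hT).comp hσ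

theorem exists_isLeast_le_modeWeight (hn : 1 ≤ n) (hα : 0 < α) (hT : 0 < T)
    (σ : ℕ+ ≃ (Fin n → ℕ+)) (c : ℝ) : ∃ N₀, IsLeast {N | c ≤ modeWeight α T (σ N)} N₀ := by
  have : Nonempty (Fin n) := ⟨⟨0, hn⟩⟩
  obtain ⟨j, hj⟩ := ((tendsto_modeWeight_cofinite (n := n) hα hT).eventually_ge_atTop c).exists
  obtain ⟨N₀, hN₀⟩ := exists_minimal_of_wellFoundedLT (fun N => c ≤ modeWeight α T (σ N))
    ⟨σ.symm j, by simpa using hj⟩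
  exact ⟨N₀, hN₀.1, fun N hN => (le_total N₀ N).elim id (hN₀.2 hN)⟩

theorem modeWeight_one_le_mul_setIntegral (hT : 0 < T) (hL : 0 < L)
    (hσ : IsOrderedEnumeration α σ) (hN : modeWeight α T (fun _ : Fin n => (1 : ℕ+)) /
      sineLowerBound n (L * Real.pi ^ n) ≤ modeWeight α T (σ N))
    {ω : Set (Fin n → ℝ)} (hω : ω ∈ admissibleSets n L) {i : ℕ+} (hi : N ≤ i) :
    modeWeight α T (fun _ : Fin n => (1 : ℕ+)) ≤
      modeWeight α T (σ i) * ∫ x in ω, sineMode (σ i) x ^ 2 := by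
  have hbound : 0 < sineLowerBound n (L * Real.pi ^ n) :=
    sineLowerBound_pos n (mul_pos hL (pow_pos Real.pi_pos n))
  calc _ ≤ modeWeight α T (σ N) * sineLowerBound n (L * Real.pi ^ n) := (div_le_iff₀ hbound).1 hN
    _ ≤ modeWeight α T (σ i) * sineLowerBound n (L * Real.pi ^ n) :=
      mul_le_mul_of_nonneg_right (monotone_modeWeight_comp hT.le hσ hi) hbound.le
    _ ≤ _ := mul_le_mul_of_nonneg_left (sineLowerBound_le_setIntegral_sineMode_sq hL.le hω _)
      (modeWeight_pos hT _).le

theorem truncFunctional_le_modeWeight_one (hT : 0 < T) (hσ : IsOrderedEnumeration α σ) (N : ℕ+)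
    {ω : Set (Fin n → ℝ)} (hω : ω ⊆ orthotope n) :
    truncFunctional α T σ N ω ≤ modeWeight α T (fun _ : Fin n => (1 : ℕ+)) :=
  calc truncFunctional α T σ N ω
      ≤ modeWeight α T (σ 1) * ∫ x in ω, sineMode (σ 1) x ^ 2 :=
        ciInf_le (Set.finite_range _).bddBelow (⟨1, Set.mem_Iic.2 one_le⟩ : Set.Iic N)
    _ ≤ modeWeight α T (σ 1) := mul_le_of_le_one_right (modeWeight_pos hT _).le
        (setIntegral_sineMode_sq_le_one _ hω)
    _ ≤ _ := by
        simpa using monotone_modeWeight_comp hT.le hσ (one_le : 1 ≤ σ.symm fun _ => 1)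

theorem eqOn_truncFunctional_obsFunctional (hT : 0 < T) (hL : 0 < L)
    (hσ : IsOrderedEnumeration α σ) (hN : modeWeight α T (fun _ : Fin n => (1 : ℕ+)) /
      sineLowerBound n (L * Real.pi ^ n) ≤ modeWeight α T (σ N)) :
    Set.EqOn (truncFunctional α T σ N) (obsFunctional α T) (admissibleSets n L) := by
  intro ω hω
  have : Nonempty (Set.Iic N) := ⟨⟨N, Set.mem_Iic.2 le_rfl⟩⟩
  have hbdd : BddBelow (Set.range fun j => modeWeight α T j * ∫ x in ω, sineMode j x ^ 2) :=
    ⟨0, Set.forall_mem_range.2 fun j =>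
      mul_nonneg (modeWeight_pos hT j).le (integral_nonneg fun x => sq_nonneg _)⟩
  refine le_antisymm (le_ciInf fun j => ?_) (le_ciInf fun i => ciInf_le hbdd (σ i))
  obtain ⟨i, rfl⟩ := σ.surjective j
  rcases le_total i N with hi | hi
  · exact ciInf_le (Set.finite_range fun i : Set.Iic N =>
      modeWeight α T (σ i) * ∫ x in ω, sineMode (σ i) x ^ 2).bddBelow ⟨i, hi⟩
  · exact (truncFunctional_le_modeWeight_one hT hσ N hω.1).trans
      (modeWeight_one_le_mul_setIntegral hT hL hσ hN hω hi)

end Optimal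

theorem theorem3 (n : ℕ) (hn : 1 ≤ n) (α T L : ℝ) (hα : 0 < α) (hT : 0 < T)
    (hL : L ∈ Set.Ioo (0 : ℝ) 1) :
    -- the uniform lower bound
    (∀ ρ : (Fin n → ℝ) → ℝ, IsDensity n ρ →
      (∀ j : Fin n → ℕ+, sineLowerBound n (∫ x in orthotope n, ρ x) ≤
        ∫ x in orthotope n, ρ x * sineMode j x ^ 2) ∧
      (0 < ∫ x in orthotope n, ρ x → 0 < sineLowerBound n (∫ x in orthotope n, ρ x))) ∧
    -- the spectral assumption
    SpectralH2 n α T L ∧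
    -- the modes can be listed by nondecreasing eigenvalue
    (∃ σ : ℕ+ ≃ (Fin n → ℕ+), IsOrderedEnumeration α σ) ∧
    -- the unique optimal set, and its determination by finitely many modes
    ∃ ω : Set (Fin n → ℝ), IsOpen ω ∧ IsSemiAnalytic ω ∧
      IsUniqueOptimalSet n L (obsFunctional α T) ω ∧
      ∀ σ : ℕ+ ≃ (Fin n → ℕ+), IsOrderedEnumeration α σ →
        ∃ N₀ : ℕ+,
          IsLeast {N : ℕ+ | modeWeight α T (fun _ : Fin n => (1 : ℕ+)) /
            sineLowerBound n (L * Real.pi ^ n) ≤ modeWeight α T (σ N)} N₀ ∧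
          ∀ N : ℕ+, N₀ ≤ N →
            IsUniqueOptimalSet n L (truncFunctional α T σ N) ω ∧
            truncFunctional α T σ N ω = obsFunctional α T ω := by
  refine ⟨fun ρ hρ => ⟨sineLowerBound_setIntegral_le hρ, sineLowerBound_pos n⟩,
    spectralH2 hα hT hL.1, exists_isOrderedEnumeration hn hα, ?_⟩
  obtain ⟨σ₀, hσ₀⟩ := exists_isOrderedEnumeration (n := n) hn hα
  obtain ⟨N₁, hN₁, -⟩ := exists_isLeast_le_modeWeight hn hα hT σ₀ _
  obtain ⟨ω, hopen, hsemi, hω⟩ := exists_isUniqueOptimalSet_truncFunctional hn α hT hL σ₀ N₁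
  have hJ := hω.congr (eqOn_truncFunctional_obsFunctional hT hL.1 hσ₀ hN₁)
  refine ⟨ω, hopen, hsemi, hJ, fun σ hσ => ?_⟩
  obtain ⟨N₀, hN₀⟩ := exists_isLeast_le_modeWeight hn hα hT σ _
  refine ⟨N₀, hN₀, fun N hN => ?_⟩
  have heq := eqOn_truncFunctional_obsFunctional hT hL.1 hσ
    (hN₀.1.trans (monotone_modeWeight_comp hT.le hσ hN))
  exact ⟨hJ.congr heq.symm, heq hJ.1⟩
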